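/- All matrices are complex. For an $n\times n$ matrix $M$ without zero entries, $M^{(-)}$ is its entrywise reciprocal (Schur inverse), and $M^{(-)T}$ the transpose of $M^{(-)}$; $\circ$ denotes the entrywise (Schur) product. An $n\times n$ matrix $W$ without zero entries is *type-II* if $WW^{(-)T}=nI$. Put $X_C(M)=CM$ and $\Delta_C(M)=C\circ M$. A pair $(A,B)$ of $n\times n$ matrices is an *invertible Jones pair* if $X_A,\Delta_B$ are invertible operators, $A$ has no zero entry, $B$ is invertible, and $X_A\Delta_BX_A=\Delta_BX_A\Delta_B$ and $X_A\Delta_{B^T}X_A=\Delta_{B^T}X_A\Delta_{B^T}$. For $D$ with $D^2=n$, a *four-weight spin model* is a tuple $(W_1,W_2,W_3,W_4;D)$ of $n\times n$ matrices with $W_1,W_4$ having no zero entries, $W_3=W_1^{(-)T}$, $W_2=W_4^{(-)T}$, $W_1W_3=W_2W_4=nI$, and, for all $i,j,k$, $$\sum_h (W_1)_{k,h}(W_1)_{h,i}(W_4)_{h,j}=D(W_4)_{i,j}(W_1)_{k,i}(W_4)_{k,j},\qquad \sum_h (W_1)_{h,k}(W_1)_{i,h}(W_4)_{j,h}=D(W_4)_{j,i}(W_1)_{i,k}(W_4)_{j,k}.$$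 A matrix $W$ is a *spin model* (with respect to $D$) if $(W,W,W^{(-)},W^{(-)};D)$ is a four-weight spin model. For an $n\times n$ matrix $W$ without zero entries, $\mathcal N_W$ is the space of matrices having every vector $We_i\circ W^{(-)}e_j$ as an eigenvector, and, for $M\in\mathcal N_W$, $\Theta_W(M)$ is the $n\times n$ matrix whose $(i,j)$ entry is the eigenvalue of $M$ on $We_i\circ W^{(-)}e_j$. A *Bose-Mesner algebra* is a linear space of $n\times n$ matrices that contains $I$ and the all-ones matrix $J$, is closed under matrix multiplication, the Schur product and the transpose, and is commutative under matrix multiplication. It is *formally self-dual* with duality map $\Psi$ if $\Psi$ is a linear bijection of it onto itself with $\Psi(MN)=\Psi(M)\circ\Psi(N)$, $\Psi(M\circ N)=\frac1n\Psi(M)\Psi(N)$, $\Psi(M^T)=\Psi(M)^T$ and $\Psi(\Psi(M))=nM^T$. **Theorem.** Let $A$ be a symmetric $n\times n$ type-II matrix, $B$ an $n\times n$ type-II matrix, and $d\in\mathbb C$ with $d^2=n$. Put $$V=\begin{pmatrix} dA&-dA&B^{(-)}&B^{(-)}\\-dA&dA&B^{(-)}&B^{(-)}\\B^{(-)T}&B^{(-)T}&dA&-dA\\B^{(-)T}&B^{(-)T}&-dA&dA\end{pmatrix}.$$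 Then $(A,B)$ is an invertible Jones pair if and only if $V$ is a spin model with respect to the square root $2d$ of its order $4n$. Moreover, if these equivalent conditions hold, then $\mathcal N_V$ is a formally self-dual Bose-Mesner algebra with duality map $\Theta_V$, and $\mathcal N_V=\mathcal N_{V^T}$, $\Theta_V=\Theta_{V^T}$. -/

import Mathlib

open scoped Matrix

namespace YamadaSpin

noncomputable section

variable {ι : Type*} [Fintype ι]

/-- All entries of the matrix are non-zero. -/
def SchurInvertible (A : Matrix ι ι ℂ) : Prop := ∀ i j, A i j ≠ 0

/-- The Schur inverse `A^{(-)}`: the entrywise reciprocal (used for Schur invertible matrices). -/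
def schurInv (A : Matrix ι ι ℂ) : Matrix ι ι ℂ := Matrix.of fun i j => (A i j)⁻¹

/-- Type-II matrices: `W` is Schur invertible and `W W^{(-)T} = n I`. -/
def IsTypeII [DecidableEq ι] (W : Matrix ι ι ℂ) : Prop :=
  SchurInvertible W ∧ W * (schurInv W)ᵀ = (Fintype.card ι : ℂ) • (1 : Matrix ι ι ℂ)

/-- The operator `X_C : M ↦ C M`. -/
def opX (C : Matrix ι ι ℂ) : Module.End ℂ (Matrix ι ι ℂ) where
  toFun M := C * M
  map_add' M N := mul_add C M N
  map_smul' c M := Matrix.mul_smul C c M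

/-- The operator `Δ_C : M ↦ C ∘ M`, where `∘` is the Schur (entrywise) product. -/
def opDelta (C : Matrix ι ι ℂ) : Module.End ℂ (Matrix ι ι ℂ) where
  toFun M := C ⊙ M
  map_add' M N := Matrix.hadamard_add C M N
  map_smul' c M := Matrix.hadamard_smul C M c

/-- Jones pairs. The product of endomorphisms is composition. -/
structure IsJonesPair (A B : Matrix ι ι ℂ) : Prop where
  isUnit_opX : IsUnit (opX A)
  isUnit_opDelta : IsUnit (opDelta B)
  braid : opX A * opDelta B * opX A = opDelta B * opX A * opDelta B
  braid_transpose : opX A * opDelta Bᵀ * opX A = opDelta Bᵀ * opX A * opDelta Bᵀ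

/-- Invertible Jones pairs: moreover `A` is Schur invertible and `B` is invertible. -/
structure IsInvertibleJonesPair [DecidableEq ι] (A B : Matrix ι ι ℂ) : Prop extends IsJonesPair A B where
  schurInvertible_left : SchurInvertible A
  isUnit_right : IsUnit B

/-- Four-weight spin models `(W₁, W₂, W₃, W₄; d)`. -/
structure IsFourWeightSpinModel [DecidableEq ι] (W₁ W₂ W₃ W₄ : Matrix ι ι ℂ) (d : ℂ) : Prop where
  sq_eq : d ^ 2 = (Fintype.card ι : ℂ)
  schurInvertible_one : SchurInvertible W₁
  schurInvertible_four : SchurInvertible W₄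
  three_eq : W₃ = (schurInv W₁)ᵀ
  two_eq : W₂ = (schurInv W₄)ᵀ
  one_mul_three : W₁ * W₃ = (Fintype.card ι : ℂ) • (1 : Matrix ι ι ℂ)
  two_mul_four : W₂ * W₄ = (Fintype.card ι : ℂ) • (1 : Matrix ι ι ℂ)
  star_triangle : ∀ i j k,
    ∑ h, W₁ k h * W₁ h i * W₄ h j = d * W₄ i j * W₁ k i * W₄ k j
  star_triangle' : ∀ i j k,
    ∑ h, W₁ h k * W₁ i h * W₄ j h = d * W₄ j i * W₁ i k * W₄ j k

/-- `W` is a spin model with respect to the square root `d` of its order. -/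
def IsSpinModel [DecidableEq ι] (W : Matrix ι ι ℂ) (d : ℂ) : Prop :=
  IsFourWeightSpinModel W W (schurInv W) (schurInv W) d

/-- The vector `A e_i ∘ B e_j`. -/
def colProd (A B : Matrix ι ι ℂ) (i j : ι) : ι → ℂ := fun k => A k i * B k j

/-- The Nomura algebra `N_{A,B}`: the matrices having all `A e_i ∘ B e_j` as eigenvectors. -/
def nomuraPair (A B : Matrix ι ι ℂ) : Submodule ℂ (Matrix ι ι ℂ) where
  carrier := {M | ∀ i j, ∃ c : ℂ, M *ᵥ colProd A B i j = c • colProd A B i j}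
  add_mem' := by
    intro M N hM hN i j
    obtain ⟨a, ha⟩ := hM i j
    obtain ⟨b, hb⟩ := hN i j
    exact ⟨a + b, by rw [Matrix.add_mulVec, ha, hb, add_smul]⟩
  zero_mem' := fun i j => ⟨0, by rw [Matrix.zero_mulVec, zero_smul]⟩
  smul_mem' := by
    intro c M hM i j
    obtain ⟨a, ha⟩ := hM i j
    exact ⟨c * a, by rw [Matrix.smul_mulVec, ha, smul_smul]⟩

open Classical in
/-- The matrix of eigenvalues `Θ_{A,B}(M)`: its `(i, j)` entry is the eigenvalue of `M` on
`A e_i ∘ B e_j`. It is meaningful for `M ∈ N_{A,B}`, when these vectors are non-zero. -/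
def thetaPair (A B M : Matrix ι ι ℂ) : Matrix ι ι ℂ :=
  Matrix.of fun i j =>
    if h : ∃ c : ℂ, M *ᵥ colProd A B i j = c • colProd A B i j then h.choose else 0

theorem thetaPair_spec {A B M : Matrix ι ι ℂ} (hM : M ∈ nomuraPair A B) (i j : ι) :
    M *ᵥ colProd A B i j = thetaPair A B M i j • colProd A B i j := by
  have h : ∃ c : ℂ, M *ᵥ colProd A B i j = c • colProd A B i j := hM i j
  simp only [thetaPair, Matrix.of_apply, dif_pos h]
  exact h.choose_spec

theorem thetaPair_unique {A B M S : Matrix ι ι ℂ} (hA : SchurInvertible A)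
    (hB : SchurInvertible B)
    (hS : ∀ i j, M *ᵥ colProd A B i j = S i j • colProd A B i j) : thetaPair A B M = S := by
  ext i j
  have h1 := thetaPair_spec (A := A) (B := B) (M := M) (fun i j => ⟨S i j, hS i j⟩) i j
  rw [hS i j] at h1
  have h2 := congrFun h1 i
  simp only [Pi.smul_apply, smul_eq_mul, colProd] at h2
  exact (mul_right_cancel₀ (mul_ne_zero (hA i i) (hB i j)) h2).symm

/-- The Nomura algebra `N_W = N_{W, W^{(-)}}`. -/
def nomura (W : Matrix ι ι ℂ) : Submodule ℂ (Matrix ι ι ℂ) := nomuraPair W (schurInv W)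

/-- The map `Θ_W = Θ_{W, W^{(-)}}`. -/
def theta (W : Matrix ι ι ℂ) : Matrix ι ι ℂ → Matrix ι ι ℂ := thetaPair W (schurInv W)

/-- Bose-Mesner algebras: spaces of matrices that contain `I` and `J`, are commutative algebras
under matrix multiplication, and are closed under the transpose and the Schur product. -/
structure IsBoseMesner [DecidableEq ι] (S : Submodule ℂ (Matrix ι ι ℂ)) : Prop where
  one_mem : (1 : Matrix ι ι ℂ) ∈ S
  allOnes_mem : (Matrix.of fun _ _ => 1 : Matrix ι ι ℂ) ∈ S
  mul_mem : ∀ M ∈ S, ∀ N ∈ S, M * N ∈ S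
  mul_comm : ∀ M ∈ S, ∀ N ∈ S, M * N = N * M
  transpose_mem : ∀ M ∈ S, Mᵀ ∈ S
  hadamard_mem : ∀ M ∈ S, ∀ N ∈ S, M ⊙ N ∈ S

/-- `Ψ` restricts to a duality map from `S` to `T`: a linear bijection that swaps the matrix
product and the Schur product (up to the factor `1/n`) and commutes with the transpose. -/
structure IsDualityMap (S T : Submodule ℂ (Matrix ι ι ℂ))
    (Ψ : Matrix ι ι ℂ → Matrix ι ι ℂ) : Prop where
  bijOn : Set.BijOn Ψ S T
  map_add : ∀ M ∈ S, ∀ N ∈ S, Ψ (M + N) = Ψ M + Ψ N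
  map_smul : ∀ c : ℂ, ∀ M ∈ S, Ψ (c • M) = c • Ψ M
  map_mul : ∀ M ∈ S, ∀ N ∈ S, Ψ (M * N) = Ψ M ⊙ Ψ N
  map_hadamard : ∀ M ∈ S, ∀ N ∈ S, Ψ (M ⊙ N) = (1 / (Fintype.card ι : ℂ)) • (Ψ M * Ψ N)
  map_transpose : ∀ M ∈ S, Ψ Mᵀ = (Ψ M)ᵀ

/-- `S` is a formally self-dual Bose-Mesner algebra with duality map `Ψ`: a Bose-Mesner algebra
on which `Ψ` is a duality map to `S` itself with `Ψ (Ψ M) = n Mᵀ`. -/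
structure IsFormallySelfDual [DecidableEq ι] (S : Submodule ℂ (Matrix ι ι ℂ))
    (Ψ : Matrix ι ι ℂ → Matrix ι ι ℂ) : Prop where
  boseMesner : IsBoseMesner S
  dualityMap : IsDualityMap S S Ψ
  apply_apply : ∀ M ∈ S, Ψ (Ψ M) = (Fintype.card ι : ℂ) • Mᵀ

/-- The `4n × 4n` matrix `V`, divided into sixteen `n × n` blocks. -/
def yamadaV (A B : Matrix ι ι ℂ) (d : ℂ) : Matrix ((ι ⊕ ι) ⊕ (ι ⊕ ι)) ((ι ⊕ ι) ⊕ (ι ⊕ ι)) ℂ :=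
  Matrix.fromBlocks
    (Matrix.fromBlocks (d • A) (-(d • A)) (-(d • A)) (d • A))
    (Matrix.fromBlocks (schurInv B) (schurInv B) (schurInv B) (schurInv B))
    (Matrix.fromBlocks (schurInv B)ᵀ (schurInv B)ᵀ (schurInv B)ᵀ (schurInv B)ᵀ)
    (Matrix.fromBlocks (d • A) (-(d • A)) (-(d • A)) (d • A))

end

end YamadaSpin

open scoped Matrix

namespace YamadaSpin

/-! ### Nomura algebras of type-II matrices and their duality. -/

section Nomura

variable {ι : Type*}

/-! The matrix `V` is symmetric and type-II as soon as `A` is symmetric type-II, `B` is type-II and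
`d ^ 2 = n`, and the duality statement rests on this alone. Orthogonality of the rows of `W` turns
the eigenvalue equation for `M` into one for `Θ_W(M)` with respect to `Wᵀ`, whose eigenvalues are
the entries of `n Mᵀ` (`IsEigenMatrix.dual`). When `Wᵀ = W` this makes `Θ_W` a duality of `N_W` with
itself (`isFormallySelfDual_nomura`).

For the equivalence, split the indices of `V` into two halves, each a pair of blocks carrying
opposite signs. In every star-triangle sum the signs cancel the contribution of one half, and the
other half contributes two equal sums over `ι`. With the third index opposite to the first two, what
remains is the braid relation itself, for `B` or `Bᵀ` according to the half
(`starTriangleAt_third_opposite_iff`). The other positions give rearrangements of the same relation,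
obtained by inverting `A` and using that `B` is type-II (`EntrywiseBraid.sum_right`,
`EntrywiseBraid.sum_inv_right`). -/

theorem SchurInvertible.schurInv {W : Matrix ι ι ℂ} (hW : SchurInvertible W) :
    SchurInvertible (schurInv W) := fun i j => inv_ne_zero (hW i j)

theorem schurInv_schurInv (W : Matrix ι ι ℂ) : schurInv (schurInv W) = W := by
  ext i j
  simp [schurInv]

variable [Fintype ι]

/-- `S` is the matrix of eigenvalues of `M` on the vectors `W e_i ∘ W^{(-)} e_j`, entrywise. -/
def IsEigenMatrix (W M S : Matrix ι ι ℂ) : Prop :=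
  ∀ k i j, ∑ h, M k h * (W h i * (W h j)⁻¹) = S i j * (W k i * (W k j)⁻¹)

theorem isEigenMatrix_iff_mulVec {W M S : Matrix ι ι ℂ} :
    IsEigenMatrix W M S ↔
      ∀ i j, M *ᵥ colProd W (schurInv W) i j = S i j • colProd W (schurInv W) i j :=
  ⟨fun h i j => funext fun k => h k i j, fun h k i j => congrFun (h i j) k⟩

theorem IsEigenMatrix.mem_nomura {W M S : Matrix ι ι ℂ} (h : IsEigenMatrix W M S) :
    M ∈ nomura W := fun i j => ⟨S i j, isEigenMatrix_iff_mulVec.1 h i j⟩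

theorem IsEigenMatrix.theta_eq {W M S : Matrix ι ι ℂ} (hW : SchurInvertible W)
    (h : IsEigenMatrix W M S) : theta W M = S :=
  thetaPair_unique hW hW.schurInv (isEigenMatrix_iff_mulVec.1 h)

theorem isEigenMatrix_theta {W M : Matrix ι ι ℂ} (hM : M ∈ nomura W) :
    IsEigenMatrix W M (theta W M) := isEigenMatrix_iff_mulVec.2 (thetaPair_spec hM)

theorem IsEigenMatrix.mul {W M N S T : Matrix ι ι ℂ} (hM : IsEigenMatrix W M S)
    (hN : IsEigenMatrix W N T) : IsEigenMatrix W (M * N) (S ⊙ T) := by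
  rw [isEigenMatrix_iff_mulVec] at *
  intro i j
  rw [← Matrix.mulVec_mulVec, hN, Matrix.mulVec_smul, hM, smul_smul, mul_comm]
  rfl

theorem IsEigenMatrix.add {W M N S T : Matrix ι ι ℂ} (hM : IsEigenMatrix W M S)
    (hN : IsEigenMatrix W N T) : IsEigenMatrix W (M + N) (S + T) := by
  rw [isEigenMatrix_iff_mulVec] at *
  intro i j
  rw [Matrix.add_mulVec, hM, hN, ← add_smul]
  rfl

theorem IsEigenMatrix.smul {W M S : Matrix ι ι ℂ} (hM : IsEigenMatrix W M S) (c : ℂ) :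
    IsEigenMatrix W (c • M) (c • S) := by
  rw [isEigenMatrix_iff_mulVec] at *
  intro i j
  rw [Matrix.smul_mulVec, hM, smul_smul]
  rfl

variable [DecidableEq ι]

theorem IsTypeII.sum_row {W : Matrix ι ι ℂ} (hW : IsTypeII W) (x y : ι) :
    ∑ w, W x w * (W y w)⁻¹ = if x = y then (Fintype.card ι : ℂ) else 0 := by
  have h := congrFun (congrFun hW.2 x) y
  simpa [Matrix.mul_apply, schurInv, Matrix.one_apply] using h

theorem IsTypeII.mul_inverse {W : Matrix ι ι ℂ} (hW : IsTypeII W) :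
    W * ((Fintype.card ι : ℂ)⁻¹ • (schurInv W)ᵀ) = 1 := by
  ext i j
  have : Nonempty ι := ⟨i⟩
  have hn : (Fintype.card ι : ℂ) ≠ 0 := Nat.cast_ne_zero.2 Fintype.card_ne_zero
  rw [Matrix.mul_smul, hW.2, smul_smul, inv_mul_cancel₀ hn, one_smul]

theorem IsTypeII.isUnit {W : Matrix ι ι ℂ} (hW : IsTypeII W) : IsUnit W :=
  IsUnit.of_mul_eq_one _ hW.mul_inverse

theorem IsTypeII.transpose {W : Matrix ι ι ℂ} (hW : IsTypeII W) : IsTypeII Wᵀ := by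
  refine ⟨fun i j => hW.1 j i, ?_⟩
  have h := congrArg Matrix.transpose (mul_eq_one_comm.1 hW.mul_inverse)
  rw [Matrix.transpose_mul, Matrix.transpose_smul, Matrix.transpose_transpose,
    Matrix.transpose_one, Matrix.mul_smul] at h
  ext i j
  have : Nonempty ι := ⟨i⟩
  have hn : (Fintype.card ι : ℂ) ≠ 0 := Nat.cast_ne_zero.2 Fintype.card_ne_zero
  rw [← h, smul_smul, mul_inv_cancel₀ hn, one_smul]
  rfl

theorem IsTypeII.sum_col {W : Matrix ι ι ℂ} (hW : IsTypeII W) (x y : ι) :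
    ∑ w, W w x * (W w y)⁻¹ = if x = y then (Fintype.card ι : ℂ) else 0 :=
  hW.transpose.sum_row x y

/-- The eigenvalue equation can be solved for the matrix entries along the first index. -/
theorem IsEigenMatrix.sum_left {W M S : Matrix ι ι ℂ} (hW : IsTypeII W)
    (h : IsEigenMatrix W M S) (k l j : ι) :
    ∑ i, S i j * (W k i * (W l i)⁻¹) = Fintype.card ι * M k l * (W k j * (W l j)⁻¹) := by
  have h1 : ∑ i, (∑ h, M k h * (W h i * (W h j)⁻¹)) * (W l i)⁻¹
      = Fintype.card ι * M k l * (W l j)⁻¹ := by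
    -- Summing over `i` first, orthogonality of the rows of `W` isolates the term `h = l`.
    calc _ = ∑ h, M k h * (W h j)⁻¹ * ∑ i, W h i * (W l i)⁻¹ := by
          simp only [Finset.sum_mul, Finset.mul_sum]
          rw [Finset.sum_comm]
          exact Finset.sum_congr rfl fun _ _ => Finset.sum_congr rfl fun _ _ => by ring
      _ = _ := by
          simp only [hW.sum_row, mul_ite, mul_zero, Finset.sum_ite_eq', Finset.mem_univ, if_true]
          ring
  have hk := hW.1 k j
  calc _ = (∑ i, S i j * (W k i * (W k j)⁻¹) * (W l i)⁻¹) * W k j := by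
        rw [Finset.sum_mul]
        exact Finset.sum_congr rfl fun i _ => by field_simp
    _ = _ := by
        simp only [← h k]
        rw [h1]
        ring

/-- The eigenvalue equation can be solved for the matrix entries along the second index. -/
theorem IsEigenMatrix.sum_right {W M S : Matrix ι ι ℂ} (hW : IsTypeII W)
    (h : IsEigenMatrix W M S) (k l i : ι) :
    ∑ j, S i j * (W l j * (W k j)⁻¹) = Fintype.card ι * M k l * (W l i * (W k i)⁻¹) := by
  have h1 : ∑ j, (∑ h, M k h * (W h i * (W h j)⁻¹)) * W l j
      = Fintype.card ι * M k l * W l i := by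
    calc _ = ∑ h, M k h * W h i * ∑ j, W l j * (W h j)⁻¹ := by
          simp only [Finset.sum_mul, Finset.mul_sum]
          rw [Finset.sum_comm]
          exact Finset.sum_congr rfl fun _ _ => Finset.sum_congr rfl fun _ _ => by ring
      _ = _ := by
          simp only [hW.sum_row, mul_ite, mul_zero, Finset.sum_ite_eq, Finset.mem_univ, if_true]
          ring
  have hk := hW.1 k i
  calc _ = (∑ j, S i j * (W k i * (W k j)⁻¹) * W l j) * (W k i)⁻¹ := by
        rw [Finset.sum_mul]
        exact Finset.sum_congr rfl fun j _ => by field_simp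
    _ = _ := by
        simp only [← h k]
        rw [h1]
        ring

/-- The equation solved for `M` is again an eigenvalue equation, now for `S` on the vectors built
from the rows of `W`. Solving along the first index instead gives the version for `Sᵀ`. -/
theorem IsEigenMatrix.dual {W M S : Matrix ι ι ℂ} (hW : IsTypeII W) (h : IsEigenMatrix W M S) :
    IsEigenMatrix Wᵀ S ((Fintype.card ι : ℂ) • Mᵀ) := fun i l k => by
  simpa using h.sum_right hW k l i

theorem IsEigenMatrix.dual_transpose {W M S : Matrix ι ι ℂ} (hW : IsTypeII W)
    (h : IsEigenMatrix W M S) : IsEigenMatrix Wᵀ Sᵀ ((Fintype.card ι : ℂ) • M) := fun j k l => by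
  simpa using h.sum_left hW k l j

theorem IsEigenMatrix.one (W : Matrix ι ι ℂ) :
    IsEigenMatrix W 1 (Matrix.of fun _ _ => 1) := by
  rw [isEigenMatrix_iff_mulVec]
  intro i j
  simp

theorem IsEigenMatrix.allOnes {W : Matrix ι ι ℂ} (hW : IsTypeII W) :
    IsEigenMatrix W (Matrix.of fun _ _ => 1) ((Fintype.card ι : ℂ) • 1) := by
  intro k i j
  by_cases hij : i = j
  · subst hij
    simp [hW.sum_col, hW.1 k i]
  · simp [hW.sum_col, hij]

/-- The eigenvalues determine an element of the Nomura algebra. -/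
theorem IsEigenMatrix.injective {W M N S : Matrix ι ι ℂ} (hW : IsTypeII W)
    (hM : IsEigenMatrix W M S) (hN : IsEigenMatrix W N S) : M = N := by
  ext k l
  have : Nonempty ι := ⟨k⟩
  have hn : (Fintype.card ι : ℂ) ≠ 0 := Nat.cast_ne_zero.2 Fintype.card_ne_zero
  have h := (hM.sum_left hW k l k).symm.trans (hN.sum_left hW k l k)
  exact mul_left_cancel₀ hn
    (mul_right_cancel₀ (mul_ne_zero (hW.1 k k) (inv_ne_zero (hW.1 l k))) h)

/-- The Nomura algebra of a symmetric type-II matrix is formally self-dual. -/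
theorem isFormallySelfDual_nomura {W : Matrix ι ι ℂ} (hW : IsTypeII W)
    (hs : Wᵀ = W) : IsFormallySelfDual (nomura W) (theta W) := by
  -- In order zero one cannot divide by `n`, but all matrices coincide.
  rcases isEmpty_or_nonempty ι with he | hne
  · have mem (M : Matrix ι ι ℂ) : M ∈ nomura W := fun i => he.elim i
    have eq (M N : Matrix ι ι ℂ) : M = N := Subsingleton.elim M N
    exact ⟨⟨mem _, mem _, fun _ _ _ _ => mem _, fun _ _ _ _ => eq _ _, fun _ _ => mem _,
      fun _ _ _ _ => mem _⟩, ⟨⟨fun _ _ => mem _, fun _ _ _ _ _ => eq _ _,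
      fun M _ => ⟨M, mem M, eq _ _⟩⟩, fun _ _ _ _ => eq _ _, fun _ _ _ => eq _ _,
      fun _ _ _ _ => eq _ _, fun _ _ _ _ => eq _ _, fun _ _ => eq _ _⟩, fun _ _ => eq _ _⟩
  have hn : (Fintype.card ι : ℂ) ≠ 0 := Nat.cast_ne_zero.2 Fintype.card_ne_zero
  set n : ℂ := (Fintype.card ι : ℂ)
  have eig {M} (hM : M ∈ nomura W) : IsEigenMatrix W M (theta W M) := isEigenMatrix_theta hM
  have dual {M} (hM : M ∈ nomura W) : IsEigenMatrix W (theta W M) (n • Mᵀ) := by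
    simpa only [hs] using (eig hM).dual hW
  have dualT {M} (hM : M ∈ nomura W) : IsEigenMatrix W (theta W M)ᵀ (n • M) := by
    simpa only [hs] using (eig hM).dual_transpose hW
  have theta_mem {M} (hM : M ∈ nomura W) : theta W M ∈ nomura W := (dual hM).mem_nomura
  have transp {M} (hM : M ∈ nomura W) : IsEigenMatrix W Mᵀ (theta W M)ᵀ := by
    -- Dualizing twice and dividing by `n` gives closure under transpose.
    have h := (dual (theta_mem hM)).smul n⁻¹
    rw [(dual hM).theta_eq hW.1, smul_smul, smul_smul, inv_mul_cancel₀ hn, one_smul,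
      one_smul] at h
    exact h
  have comm {M} (hM : M ∈ nomura W) {N} (hN : N ∈ nomura W) : M * N = N * M := by
    refine ((eig hM).mul (eig hN)).injective hW ?_
    rw [Matrix.hadamard_comm]
    exact (eig hN).mul (eig hM)
  have had {M} (hM : M ∈ nomura W) {N} (hN : N ∈ nomura W) :
      IsEigenMatrix W (M ⊙ N) ((1 / n) • (theta W M * theta W N)) := by
    -- `M` and `N` are the eigenvalue matrices of `n⁻¹ Θ(M)ᵀ` and `n⁻¹ Θ(N)ᵀ`, so `M ⊙ N` is that of
    -- their product; dualizing puts `M ⊙ N` in the algebra.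
    have h1 := ((dualT hM).smul n⁻¹).mul ((dualT hN).smul n⁻¹)
    rw [smul_smul, smul_smul, inv_mul_cancel₀ hn, one_smul, one_smul] at h1
    have h2 := h1.dual hW
    rw [hs] at h2
    convert h2 using 1
    rw [comm (theta_mem hM) (theta_mem hN), Matrix.transpose_mul, Matrix.transpose_smul,
      Matrix.transpose_smul, Matrix.transpose_transpose, Matrix.transpose_transpose,
      Matrix.smul_mul, Matrix.mul_smul, smul_smul, smul_smul]
    congr 1
    change 1 / n = n * n⁻¹ * n⁻¹
    field_simp
  refine ⟨⟨(IsEigenMatrix.one W).mem_nomura, (IsEigenMatrix.allOnes hW).mem_nomura,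
    fun M hM N hN => ((eig hM).mul (eig hN)).mem_nomura, fun M hM N hN => comm hM hN,
    fun M hM => (transp hM).mem_nomura, fun M hM N hN => (had hM hN).mem_nomura⟩,
    ⟨⟨fun M hM => theta_mem hM, fun M hM N hN h => ?_, fun M hM => ?_⟩,
      fun M hM N hN => ((eig hM).add (eig hN)).theta_eq hW.1,
      fun c M hM => ((eig hM).smul c).theta_eq hW.1,
      fun M hM N hN => ((eig hM).mul (eig hN)).theta_eq hW.1,
      fun M hM N hN => (had hM hN).theta_eq hW.1,
      fun M hM => (transp hM).theta_eq hW.1⟩,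
    fun M hM => (dual hM).theta_eq hW.1⟩
  · have h' := eig hM
    rw [h] at h'
    exact h'.injective hW (eig hN)
  · have h := (dualT hM).smul n⁻¹
    rw [smul_smul, inv_mul_cancel₀ hn, one_smul] at h
    exact ⟨_, h.mem_nomura, h.theta_eq hW.1⟩

/-- For a symmetric matrix, the two star-triangle equations of a spin model coincide. -/
theorem isSpinModel_iff_of_symm {W : Matrix ι ι ℂ} {d : ℂ} (hs : Wᵀ = W) (hW : IsTypeII W)
    (hd : d ^ 2 = (Fintype.card ι : ℂ)) :
    IsSpinModel W d ↔ ∀ k i j,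
      ∑ h, W k h * W h i * (W h j)⁻¹ = d * (W i j)⁻¹ * W k i * (W k j)⁻¹ := by
  have hsymm (i j) : W i j = W j i := congrFun (congrFun hs j) i
  have hinv : (schurInv W)ᵀ = schurInv W := by
    ext i j
    simp [schurInv, hsymm i j]
  constructor
  · intro h k i j
    exact h.star_triangle i j k
  · intro h
    refine ⟨hd, hW.1, hW.1.schurInv, hinv.symm, ?_, ?_, ?_, fun i j k => h k i j,
      fun i j k => ?_⟩
    · rw [schurInv_schurInv, hs]
    · rw [← hW.2, hinv]
    · rw [← hW.2, hinv]
    · calc _ = ∑ h, W k h * W h i * (W h j)⁻¹ := Finset.sum_congr rfl fun w _ => by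
            rw [hsymm k w, hsymm w i, hsymm w j]
            rfl
        _ = _ := by
            rw [h, hsymm i j, hsymm k i, hsymm k j]
            rfl

end Nomura

/-! ### The braid relation in coordinates and its equivalent forms. -/

section JonesPair

variable {ι : Type*} [Fintype ι]

/-- The braid relation `X_A Δ_B X_A = Δ_B X_A Δ_B`, entrywise. -/
def EntrywiseBraid (A B : Matrix ι ι ℂ) : Prop :=
  ∀ k p q, ∑ h, A k h * A h p * B h q = A k p * B k q * B p q

theorem opX_mul_opDelta_mul_opX_eq_iff (A B : Matrix ι ι ℂ) :
    opX A * opDelta B * opX A = opDelta B * opX A * opDelta B ↔ EntrywiseBraid A B := by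
  classical
  have key (M : Matrix ι ι ℂ) (k q) : (opX A * opDelta B * opX A) M k q
      = ∑ p, (∑ h, A k h * A h p * B h q) * M p q := by
    change ∑ h, A k h * (B h q * ∑ p, A h p * M p q) = _
    simp only [Finset.mul_sum, Finset.sum_mul]
    rw [Finset.sum_comm]
    exact Finset.sum_congr rfl fun _ _ => Finset.sum_congr rfl fun _ _ => by ring
  have key' (M : Matrix ι ι ℂ) (k q) : (opDelta B * opX A * opDelta B) M k q
      = ∑ p, A k p * B k q * B p q * M p q := by
    change B k q * ∑ p, A k p * (B p q * M p q) = _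
    rw [Finset.mul_sum]
    exact Finset.sum_congr rfl fun _ _ => by ring
  constructor
  · intro h k p q
    -- Evaluating at a matrix unit picks out the coefficient of `M p q`.
    have h1 := congrFun (congrFun (LinearMap.congr_fun h (Matrix.single p q 1)) k) q
    rw [key, key'] at h1
    simpa [Matrix.single_apply] using h1
  · intro h
    refine LinearMap.ext fun M => ?_
    ext k q
    rw [key, key']
    exact Finset.sum_congr rfl fun p _ => by rw [h]

theorem isUnit_opDelta {B : Matrix ι ι ℂ} (hB : SchurInvertible B) : IsUnit (opDelta B) := by
  refine IsUnit.of_mul_eq_one (opDelta (schurInv B)) (LinearMap.ext fun M => ?_)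
  ext i j
  exact mul_inv_cancel_left₀ (hB i j) (M i j)

variable [DecidableEq ι]

theorem isUnit_opX {A : Matrix ι ι ℂ} (hA : IsUnit A) : IsUnit (opX A) := by
  obtain ⟨C, hC⟩ := hA.exists_right_inv
  refine IsUnit.of_mul_eq_one (opX C) (LinearMap.ext fun M => ?_)
  change A * (C * M) = M
  rw [← mul_assoc, hC, one_mul]

theorem isInvertibleJonesPair_iff {A B : Matrix ι ι ℂ} (hA : IsTypeII A) (hB : IsTypeII B) :
    IsInvertibleJonesPair A B ↔ EntrywiseBraid A B ∧ EntrywiseBraid A Bᵀ := by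
  rw [← opX_mul_opDelta_mul_opX_eq_iff, ← opX_mul_opDelta_mul_opX_eq_iff]
  exact ⟨fun h => ⟨h.braid, h.braid_transpose⟩, fun h =>
    ⟨⟨isUnit_opX hA.isUnit, isUnit_opDelta hB.1, h.1, h.2⟩, hA.1, hB.isUnit⟩⟩

variable {A B : Matrix ι ι ℂ}

/-- The braid relation solved for the action of the inverse of `A`. -/
theorem EntrywiseBraid.sum_inv_left (h : EntrywiseBraid A B) (hs : Aᵀ = A) (hA : IsTypeII A)
    (hB : SchurInvertible B) (k p q : ι) :
    ∑ w, (A k w)⁻¹ * A w p * B w q = Fintype.card ι * (B p q)⁻¹ * A k p * B k q := by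
  have hsymm (i j) : A i j = A j i := congrFun (congrFun hs j) i
  have hp := hB p q
  calc _ = (∑ w, (A k w)⁻¹ * (A w p * B w q * B p q)) * (B p q)⁻¹ := by
        rw [Finset.sum_mul]
        exact Finset.sum_congr rfl fun w _ => by field_simp
    _ = (∑ v, A v p * B v q * ∑ w, A v w * (A k w)⁻¹) * (B p q)⁻¹ := by
        simp only [← h _ p q, Finset.mul_sum]
        rw [Finset.sum_comm]
        congr 1
        exact Finset.sum_congr rfl fun v _ => Finset.sum_congr rfl fun w _ => by
          rw [hsymm w v]
          ring
    _ = _ := by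
        simp only [hA.sum_row, mul_ite, mul_zero, Finset.sum_ite_eq', Finset.mem_univ, if_true]
        ring

/-- The form of the braid relation that involves only sums of entries of `B`. -/
theorem EntrywiseBraid.sum_right (h : EntrywiseBraid A B) (hs : Aᵀ = A) (hA : IsTypeII A)
    (hB : IsTypeII B) (x y z : ι) :
    ∑ w, (B x w)⁻¹ * (B y w)⁻¹ * B z w = A x y * (A x z)⁻¹ * (A y z)⁻¹ := by
  have hsymm (i j) : A i j = A j i := congrFun (congrFun hs j) i
  have : Nonempty ι := ⟨x⟩
  have hn : (Fintype.card ι : ℂ) ≠ 0 := Nat.cast_ne_zero.2 Fintype.card_ne_zero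
  have hz := hA.1 x z
  -- With the factor `n * A x z`, each summand is the right side of `sum_inv_left` times `(B y
  -- q)⁻¹`; summing over `q` then uses the orthogonality of the rows of `B`.
  refine mul_left_cancel₀ (mul_ne_zero hn hz) ?_
  calc _ = ∑ q, (∑ w, (A z w)⁻¹ * A w x * B w q) * (B y q)⁻¹ := by
        rw [Finset.mul_sum]
        refine Finset.sum_congr rfl fun q _ => ?_
        rw [h.sum_inv_left hs hA hB.1, hsymm z x]
        ring
    _ = ∑ w, (A z w)⁻¹ * A w x * ∑ q, B w q * (B y q)⁻¹ := by
        simp only [Finset.sum_mul, Finset.mul_sum]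
        rw [Finset.sum_comm]
        exact Finset.sum_congr rfl fun _ _ => Finset.sum_congr rfl fun _ _ => by ring
    _ = _ := by
        simp only [hB.sum_row, mul_ite, mul_zero, Finset.sum_ite_eq',
          Finset.mem_univ, if_true]
        rw [hsymm z y, hsymm y x]
        field_simp

/-- The form of the braid relation that involves the reciprocals of the entries of `B`. -/
theorem EntrywiseBraid.sum_inv_right (h : EntrywiseBraid A B) (hs : Aᵀ = A) (hA : IsTypeII A)
    (hB : SchurInvertible B) (x y z : ι) :
    ∑ w, A x w * (B w y)⁻¹ * (A w z)⁻¹ = B z y * (B x y)⁻¹ * (A x z)⁻¹ := by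
  have hsymm (i j) : A i j = A j i := congrFun (congrFun hs j) i
  have : Nonempty ι := ⟨x⟩
  have hn : (Fintype.card ι : ℂ) ≠ 0 := Nat.cast_ne_zero.2 Fintype.card_ne_zero
  -- For fixed `y` the braid relation reads `A D A = D A D`, with `D` the diagonal matrix of column
  -- `y` of `B`. Here `C = A⁻¹` and `E = D⁻¹`, and the claim is the entrywise form of `A D⁻¹ A⁻¹ =
  -- D⁻¹ A⁻¹ D`.
  set C := (Fintype.card ι : ℂ)⁻¹ • (schurInv A)ᵀ with hC
  set D := Matrix.diagonal fun w => B w y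
  set E := Matrix.diagonal fun w => (B w y)⁻¹
  have hAC : A * C = 1 := hA.mul_inverse
  have hCA : C * A = 1 := mul_eq_one_comm.1 hAC
  have hDE : D * E = 1 := by
    rw [Matrix.diagonal_mul_diagonal, ← Matrix.diagonal_one]
    exact congrArg Matrix.diagonal (funext fun w => mul_inv_cancel₀ (hB w y))
  have hED : E * D = 1 := mul_eq_one_comm.1 hDE
  have hbraid : A * D * A = D * A * D := by
    ext k p
    rw [Matrix.mul_apply, Matrix.mul_diagonal, Matrix.diagonal_mul, mul_comm (B k y), ← h k p y]
    exact Finset.sum_congr rfl fun w _ => by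
      rw [Matrix.mul_diagonal]
      ring
  have key : A * E * C = E * C * D := by
    calc A * E * C = E * D * (A * E * C) := by rw [hED, one_mul]
      _ = E * (C * A) * (D * (A * E * C)) := by rw [hCA, mul_one, mul_assoc]
      _ = E * C * (A * D * A) * (E * C) := by simp only [mul_assoc]
      _ = E * C * D * (A * (D * E) * C) := by
        rw [hbraid]
        simp only [mul_assoc]
      _ = E * C * D := by rw [hDE, mul_one, hAC, mul_one]
  have h1 := congrFun (congrFun key x) z
  rw [Matrix.mul_apply, Matrix.mul_diagonal, Matrix.diagonal_mul] at h1
  simp only [E, Matrix.mul_diagonal, hC, Matrix.smul_apply, Matrix.transpose_apply, schurInv,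
    Matrix.of_apply, smul_eq_mul] at h1
  refine mul_left_cancel₀ (inv_ne_zero hn) ?_
  calc _ = ∑ w, A x w * (B w y)⁻¹ * ((Fintype.card ι : ℂ)⁻¹ * (A z w)⁻¹) := by
        rw [Finset.mul_sum]
        exact Finset.sum_congr rfl fun w _ => by
          rw [hsymm w z]
          ring
    _ = _ := by
        rw [h1, hsymm z x]
        ring

end JonesPair

/-! ### The block structure of `V` and its star-triangle equations. -/

section YamadaV

variable {ι : Type*}

/-- The index `p` in the block with number `(a, s)`. -/
def blockIdx : Bool → Bool → ι → (ι ⊕ ι) ⊕ (ι ⊕ ι)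
  | true, true, p => Sum.inl (Sum.inl p)
  | true, false, p => Sum.inl (Sum.inr p)
  | false, true, p => Sum.inr (Sum.inl p)
  | false, false, p => Sum.inr (Sum.inr p)

theorem exists_blockIdx (k : (ι ⊕ ι) ⊕ (ι ⊕ ι)) : ∃ a s p, k = blockIdx a s p := by
  rcases k with (p | p) | (p | p)
  exacts [⟨true, true, p, rfl⟩, ⟨true, false, p, rfl⟩, ⟨false, true, p, rfl⟩,
    ⟨false, false, p, rfl⟩]

theorem blockIdx_inj {a s b t : Bool} {x y : ι} :
    blockIdx a s x = blockIdx b t y ↔ a = b ∧ s = t ∧ x = y := by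
  cases a <;> cases s <;> cases b <;> cases t <;> simp [blockIdx]

theorem eq_or_eq_not (a b : Bool) : b = a ∨ b = !a := by
  cases a <;> cases b <;> simp

/-- The sign attached to a Boolean. -/
def boolSign (s : Bool) : ℂ := if s then 1 else -1

theorem boolSign_true : boolSign true = 1 := rfl

theorem boolSign_false : boolSign false = -1 := rfl

theorem boolSign_mul_self (s : Bool) : boolSign s * boolSign s = 1 := by
  cases s <;> simp [boolSign]

theorem boolSign_ne_zero (s : Bool) : boolSign s ≠ 0 := by
  cases s <;> simp [boolSign]

theorem boolSign_inv (s : Bool) : (boolSign s)⁻¹ = boolSign s := by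
  cases s <;> simp [boolSign]

/-- `B` for `true` and `Bᵀ` for `false`. -/
def twist (B : Matrix ι ι ℂ) (a : Bool) : Matrix ι ι ℂ := if a then B else Bᵀ

theorem yamadaV_same (A B : Matrix ι ι ℂ) (d : ℂ) (a s t : Bool) (x y : ι) :
    yamadaV A B d (blockIdx a s x) (blockIdx a t y) = boolSign s * boolSign t * (d * A x y) := by
  cases a <;> cases s <;> cases t <;> simp [yamadaV, blockIdx, boolSign]

theorem yamadaV_not_right (A B : Matrix ι ι ℂ) (d : ℂ) (a s t : Bool) (x y : ι) :
    yamadaV A B d (blockIdx a s x) (blockIdx (!a) t y) = (twist B a x y)⁻¹ := by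
  cases a <;> cases s <;> cases t <;> simp [yamadaV, blockIdx, twist, schurInv]

theorem yamadaV_not_left (A B : Matrix ι ι ℂ) (d : ℂ) (a s t : Bool) (x y : ι) :
    yamadaV A B d (blockIdx (!a) s x) (blockIdx a t y) = (twist B a y x)⁻¹ := by
  cases a <;> cases s <;> cases t <;> simp [yamadaV, blockIdx, twist, schurInv]

theorem yamadaV_transpose {A : Matrix ι ι ℂ} (hs : Aᵀ = A) (B : Matrix ι ι ℂ) (d : ℂ) :
    (yamadaV A B d)ᵀ = yamadaV A B d := by
  simp [yamadaV, Matrix.fromBlocks_transpose, hs]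

variable [Fintype ι]

/-- Pairing the two signs over each `w` makes the cancellations termwise; listing half `a` first
treats both halves uniformly. -/
theorem sum_blockIdx (a : Bool) (f : (ι ⊕ ι) ⊕ (ι ⊕ ι) → ℂ) :
    ∑ h, f h = ∑ w, (f (blockIdx a true w) + f (blockIdx a false w))
      + ∑ w, (f (blockIdx (!a) true w) + f (blockIdx (!a) false w)) := by
  simp only [Fintype.sum_sum_type, Finset.sum_add_distrib]
  cases a <;> simp only [blockIdx, Bool.not_true, Bool.not_false]
  ring

theorem card_blocks : (Fintype.card ((ι ⊕ ι) ⊕ (ι ⊕ ι)) : ℂ) = 4 * Fintype.card ι := by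
  simp only [Fintype.card_sum]
  push_cast
  ring

theorem ne_zero_of_sq_eq_card {d : ℂ} (hd : d ^ 2 = (Fintype.card ι : ℂ)) (x : ι) : d ≠ 0 := by
  have : Nonempty ι := ⟨x⟩
  refine ne_zero_pow two_ne_zero ?_
  rw [hd]
  exact Nat.cast_ne_zero.2 Fintype.card_ne_zero

/-- The star-triangle equation of `W` at one triple of indices. -/
def StarTriangleAt (W : Matrix ι ι ℂ) (d : ℂ) (k i j : ι) : Prop :=
  ∑ h, W k h * W h i * (W h j)⁻¹ = d * (W i j)⁻¹ * W k i * (W k j)⁻¹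

theorem StarTriangleAt.symm {W : Matrix ι ι ℂ} {d : ℂ} (hs : Wᵀ = W) {k i j : ι}
    (h : StarTriangleAt W d k i j) : StarTriangleAt W d i k j := by
  have hsymm (i j) : W i j = W j i := congrFun (congrFun hs j) i
  unfold StarTriangleAt at *
  calc _ = ∑ h, W k h * W h i * (W h j)⁻¹ := Finset.sum_congr rfl fun w _ => by
        rw [hsymm i w, hsymm k w]
        ring
    _ = _ := by
        rw [h, hsymm i k]
        ring

variable {A B : Matrix ι ι ℂ} {d : ℂ}

/-- For `h` in half `a` the sign of `h` occurs twice and drops out; for `h` in the other half it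
occurs once and the terms cancel in pairs. -/
theorem starTriangleAt_third_opposite_iff (hd : d ^ 2 = (Fintype.card ι : ℂ)) (a s t u : Bool)
    (x y z : ι) :
    StarTriangleAt (yamadaV A B d) (2 * d) (blockIdx a s x) (blockIdx a t y) (blockIdx (!a) u z) ↔
    ∑ w, A x w * A w y * twist B a w z = A x y * twist B a x z * twist B a y z := by
  have hdx := ne_zero_of_sq_eq_card hd x
  have h1 (r : Bool) (w : ι) : boolSign s * boolSign r * (d * A x w)
      * (boolSign r * boolSign t * (d * A w y)) * twist B a w z
      = boolSign s * boolSign t * d ^ 2 * (A x w * A w y * twist B a w z) := by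
    linear_combination (boolSign s * boolSign t * d ^ 2 * (A x w * A w y * twist B a w z)) *
      boolSign_mul_self r
  have h2 (w : ι) : (twist B a x w)⁻¹ * (twist B a y w)⁻¹
      * (boolSign true * boolSign u * (d * A w z))⁻¹ + (twist B a x w)⁻¹ * (twist B a y w)⁻¹
      * (boolSign false * boolSign u * (d * A w z))⁻¹ = 0 := by
    simp [boolSign_true, boolSign_false]
  have hc : 2 * (boolSign s * boolSign t * d ^ 2) ≠ 0 := mul_ne_zero two_ne_zero
    (mul_ne_zero (mul_ne_zero (boolSign_ne_zero _) (boolSign_ne_zero _)) (pow_ne_zero _ hdx))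
  rw [StarTriangleAt, sum_blockIdx a]
  simp only [yamadaV_same, yamadaV_not_right, yamadaV_not_left, inv_inv, h1, h2,
    Finset.sum_const_zero, add_zero, ← two_mul, ← Finset.mul_sum]
  refine Iff.trans ?_ (mul_right_inj' hc)
  refine Eq.congr ?_ ?_ <;> ring

variable [DecidableEq ι]

theorem isTypeII_twist (hB : IsTypeII B) (a : Bool) : IsTypeII (twist B a) := by
  cases a
  exacts [hB.transpose, hB]

/-- For two rows in the same half, the half itself contributes `±2n` or `0` and the other half `2n`
or `0`, so unequal signs cancel. For rows in different halves the signs cancel within each half. -/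
theorem isTypeII_yamadaV (hA : IsTypeII A) (hB : IsTypeII B)
    (hd : d ^ 2 = (Fintype.card ι : ℂ)) : IsTypeII (yamadaV A B d) := by
  refine ⟨fun k i => ?_, ?_⟩
  · obtain ⟨a, s, x, rfl⟩ := exists_blockIdx k
    obtain ⟨b, t, y, rfl⟩ := exists_blockIdx i
    obtain rfl | rfl := eq_or_eq_not a b
    · rw [yamadaV_same]
      exact mul_ne_zero (mul_ne_zero (boolSign_ne_zero _) (boolSign_ne_zero _))
        (mul_ne_zero (ne_zero_of_sq_eq_card hd x) (hA.1 x y))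
    · rw [yamadaV_not_right]
      exact inv_ne_zero ((isTypeII_twist hB a).1 x y)
  · ext k i
    obtain ⟨a, s, x, rfl⟩ := exists_blockIdx k
    obtain ⟨b, t, y, rfl⟩ := exists_blockIdx i
    have hdx := ne_zero_of_sq_eq_card hd x
    simp only [Matrix.mul_apply, Matrix.transpose_apply, schurInv, Matrix.of_apply,
      Matrix.smul_apply, Matrix.one_apply, blockIdx_inj, smul_eq_mul, card_blocks]
    rw [sum_blockIdx a]
    obtain rfl | rfl := eq_or_eq_not a b
    · have h1 (r : Bool) (w : ι) : boolSign s * boolSign r * (d * A x w)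
          * (boolSign t * boolSign r * (d * A y w))⁻¹
          = boolSign s * boolSign t * (A x w * (A y w)⁻¹) := by
        rw [mul_inv, mul_inv, mul_inv, boolSign_inv, boolSign_inv]
        linear_combination (boolSign s * boolSign t * A x w * (A y w)⁻¹) *
          (d * d⁻¹ * boolSign_mul_self r + mul_inv_cancel₀ hdx)
      have h2 (w : ι) : (twist B b x w)⁻¹ * ((twist B b y w)⁻¹)⁻¹
          = twist B b y w * (twist B b x w)⁻¹ := by
        rw [inv_inv, mul_comm]
      simp only [yamadaV_same, yamadaV_not_right, h1, h2, Finset.sum_add_distrib,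
        ← Finset.mul_sum, hA.sum_row, (isTypeII_twist hB b).sum_row]
      by_cases hxy : x = y
      · subst hxy
        cases s <;> cases t <;> simp [boolSign] <;> ring
      · simp [hxy, Ne.symm hxy]
    · simp only [yamadaV_same, yamadaV_not_right, yamadaV_not_left]
      simp [boolSign_true, boolSign_false]

theorem starTriangleAt_second_opposite (hs : Aᵀ = A) (hd : d ^ 2 = (Fintype.card ι : ℂ))
    (hA : IsTypeII A) (hB : IsTypeII B) {a : Bool} (h : EntrywiseBraid A (twist B a))
    (s t u : Bool) (x y z : ι) :
    StarTriangleAt (yamadaV A B d) (2 * d) (blockIdx a s x) (blockIdx (!a) t y)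
      (blockIdx a u z) := by
  have hdx := ne_zero_of_sq_eq_card hd x
  have h1 (r : Bool) (w : ι) : boolSign s * boolSign r * (d * A x w)
      * (twist B a w y)⁻¹ * (boolSign r * boolSign u * (d * A w z))⁻¹
      = boolSign s * boolSign u * (A x w * (twist B a w y)⁻¹ * (A w z)⁻¹) := by
    rw [mul_inv, mul_inv, mul_inv, boolSign_inv, boolSign_inv]
    linear_combination (boolSign s * boolSign u * (A x w * (twist B a w y)⁻¹ * (A w z)⁻¹)) *
      (d * d⁻¹ * boolSign_mul_self r + mul_inv_cancel₀ hdx)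
  have h2 (w : ι) : (twist B a x w)⁻¹ * (boolSign true * boolSign t * (d * A w y))
      * twist B a z w + (twist B a x w)⁻¹ * (boolSign false * boolSign t * (d * A w y))
      * twist B a z w = 0 := by
    simp [boolSign_true, boolSign_false]
  rw [StarTriangleAt, sum_blockIdx a]
  simp only [yamadaV_same, yamadaV_not_right, yamadaV_not_left, inv_inv, h1, h2,
    Finset.sum_const_zero, add_zero, ← two_mul, ← Finset.mul_sum,
    h.sum_inv_right hs hA (isTypeII_twist hB a).1]
  rw [mul_inv, mul_inv, mul_inv, boolSign_inv, boolSign_inv]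
  field_simp

/-- The sign of `h` occurs three times inside half `a`, so only the other half survives, where just
entries of `twist B a` appear; this is `EntrywiseBraid.sum_right`. -/
theorem starTriangleAt_same (hs : Aᵀ = A) (hd : d ^ 2 = (Fintype.card ι : ℂ))
    (hA : IsTypeII A) (hB : IsTypeII B) {a : Bool} (h : EntrywiseBraid A (twist B a))
    (s t u : Bool) (x y z : ι) :
    StarTriangleAt (yamadaV A B d) (2 * d) (blockIdx a s x) (blockIdx a t y)
      (blockIdx a u z) := by
  have hdx := ne_zero_of_sq_eq_card hd x
  have h1 (w : ι) : boolSign s * boolSign true * (d * A x w)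
      * (boolSign true * boolSign t * (d * A w y)) * (boolSign true * boolSign u * (d * A w z))⁻¹
      + boolSign s * boolSign false * (d * A x w) * (boolSign false * boolSign t * (d * A w y))
      * (boolSign false * boolSign u * (d * A w z))⁻¹ = 0 := by
    simp [boolSign_true, boolSign_false]
  rw [StarTriangleAt, sum_blockIdx a]
  simp only [yamadaV_same, yamadaV_not_right, yamadaV_not_left, inv_inv, h1,
    Finset.sum_const_zero, zero_add, ← two_mul, ← Finset.mul_sum,
    h.sum_right hs hA (isTypeII_twist hB a)]
  simp only [mul_inv, boolSign_inv]
  -- The coefficients telescope `s²t²u² - 1` over the signs, and then `d²d⁻² - 1`.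
  linear_combination (-2 * A x y * (A x z)⁻¹ * (A y z)⁻¹) *
    (d ^ 2 * d⁻¹ ^ 2 * (boolSign s ^ 2 * boolSign u ^ 2 * boolSign_mul_self t
      + boolSign u ^ 2 * boolSign_mul_self s + boolSign_mul_self u)
      + (d * d⁻¹ + 1) * mul_inv_cancel₀ hdx)

theorem entrywiseBraid_iff_starTriangleAt (hs : Aᵀ = A) (hd : d ^ 2 = (Fintype.card ι : ℂ))
    (hA : IsTypeII A) (hB : IsTypeII B) :
    EntrywiseBraid A B ∧ EntrywiseBraid A Bᵀ ↔
      ∀ k i j, StarTriangleAt (yamadaV A B d) (2 * d) k i j := by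
  constructor
  · intro h k i j
    have hb (a : Bool) : EntrywiseBraid A (twist B a) := by
      cases a
      exacts [h.2, h.1]
    obtain ⟨a, s, x, rfl⟩ := exists_blockIdx k
    obtain ⟨b, t, y, rfl⟩ := exists_blockIdx i
    obtain ⟨c, u, z, rfl⟩ := exists_blockIdx j
    obtain rfl | rfl := eq_or_eq_not a b
    · obtain rfl | rfl := eq_or_eq_not b c
      · exact starTriangleAt_same hs hd hA hB (hb c) s t u x y z
      · exact (starTriangleAt_third_opposite_iff hd b s t u x y z).2 (hb b x y z)
    · obtain rfl | rfl := eq_or_eq_not a c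
      · exact starTriangleAt_second_opposite hs hd hA hB (hb c) s t u x y z
      -- Here the first index is the odd one out; exchanging the first two reduces to the preceding
      -- case, seen from the half `!a`.
      · refine StarTriangleAt.symm (yamadaV_transpose hs B d) ?_
        simpa using starTriangleAt_second_opposite hs hd hA hB (hb (!a)) t s u y x z
  · intro h
    exact ⟨fun k p q => (starTriangleAt_third_opposite_iff hd true true true true k p q).1
      (h _ _ _), fun k p q => (starTriangleAt_third_opposite_iff hd false true true true k p q).1
      (h _ _ _)⟩

theorem isInvertibleJonesPair_iff_isSpinModel (hs : Aᵀ = A)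
    (hd : d ^ 2 = (Fintype.card ι : ℂ)) (hA : IsTypeII A) (hB : IsTypeII B) :
    IsInvertibleJonesPair A B ↔ IsSpinModel (yamadaV A B d) (2 * d) := by
  rw [isInvertibleJonesPair_iff hA hB, entrywiseBraid_iff_starTriangleAt hs hd hA hB,
    isSpinModel_iff_of_symm (yamadaV_transpose hs B d) (isTypeII_yamadaV hA hB hd)
      (by rw [card_blocks, ← hd]; ring)]
  rfl

end YamadaV

end YamadaSpin

open YamadaSpin in
theorem mainTheorem1 (n : ℕ) (A B : Matrix (Fin n) (Fin n) ℂ) (d : ℂ)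
    (hd : d ^ 2 = (n : ℂ)) (hsymm : Aᵀ = A) (hA : IsTypeII A) (hB : IsTypeII B) :
    (IsInvertibleJonesPair A B ↔ IsSpinModel (yamadaV A B d) (2 * d)) ∧
    (IsSpinModel (yamadaV A B d) (2 * d) →
      IsFormallySelfDual (nomura (yamadaV A B d)) (theta (yamadaV A B d)) ∧
      nomura (yamadaV A B d) = nomura (yamadaV A B d)ᵀ ∧
      Set.EqOn (theta (yamadaV A B d)) (theta (yamadaV A B d)ᵀ)
        (nomura (yamadaV A B d))) := by
  have hd' : d ^ 2 = (Fintype.card (Fin n) : ℂ) := by rw [hd, Fintype.card_fin]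
  have hs := yamadaV_transpose hsymm B d
  refine ⟨isInvertibleJonesPair_iff_isSpinModel hsymm hd' hA hB, fun _ => ⟨?_, ?_, ?_⟩⟩
  · exact isFormallySelfDual_nomura (isTypeII_yamadaV hA hB hd') hs
  · rw [hs]
  · rw [hs]
    exact fun _ _ => rfl
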